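/- Let $\Pr_x$ denote probability over $x$ uniformly distributed on $\{-1,1\}^n$. There exist functions $N_0, N_1 : (0,1) \to \mathbb{Z}_{>0}$ with $N_0(\eta) = \Theta(1/\eta^3)$ and $N_1(\eta) = \Theta(1/\eta^7)$ (the implied constants being absolute and the bounds holding for all $0<\eta<1$) such that the following holds for every $0<\eta<1$ and every positive integer $n$. Let $V$ be any linear subspace of the space of real multilinear polynomials in $n$ variables of degree at most $2$, with $\dim(V) > N_1(\eta)$, and let $$Z(V) = \{x \in \{-1,1\}^n : p(x) = 0 \text{ for all } p \in V\}.$$ Then there exists a non-constant (not necessarily homogeneous) linear function $L(x) = c + \sum_{i=1}^n a_i x_i$ with real coefficients, at most $N_0(\eta)$ of the coefficients $c, a_1, \dots, a_n$ being non-zero, such that $$\Pr_x\left[x \in Z(V) \text{ and } L(x) \neq 0\right] \leq \eta.$$ -/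

import Mathlib

/-- The Boolean hypercube `{-1, 1}ⁿ`, as a finite set of points of `ℝⁿ`. -/
noncomputable def boolCube (n : ℕ) : Finset (Fin n → ℝ) :=
  Fintype.piFinset fun _ => {-1, 1}

open Classical in
/-- `Pr_x[x ∈ E]` for `x` uniformly distributed on `{-1, 1}ⁿ`. -/
noncomputable def cubeProb (n : ℕ) (E : Set (Fin n → ℝ)) : ℝ :=
  (((boolCube n).filter fun x => x ∈ E).card : ℝ) / ((boolCube n).card : ℝ)

/-- The real multilinear polynomials in `n` variables of total degree at most `d`. -/
noncomputable def multilinearPoly (n d : ℕ) : Submodule ℝ (MvPolynomial (Fin n) ℝ) :=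
  MvPolynomial.restrictTotalDegree (Fin n) ℝ d ⊓ MvPolynomial.restrictDegree (Fin n) ℝ 1

/-- `Z(V)`: the points of `{-1, 1}ⁿ` at which every polynomial of `V` vanishes. -/
def cubeZeros {n : ℕ} (V : Submodule ℝ (MvPolynomial (Fin n) ℝ)) : Set (Fin n → ℝ) :=
  {x | x ∈ boolCube n ∧ ∀ p ∈ V, MvPolynomial.eval x p = 0}

/-! Write Pr for density in the cube and r for the number of variables occurring in V. If Pr[Z(V)] ≤
η, any coordinate serves as L. Otherwise L is a partial derivative of a generic p in V.

Many variables occur: when Z(V) has density above η, `finrank_quadratic_le` gives dim V = O(r/η), so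
r ≥ 64/η⁴. As a real space is not a finite union of proper subspaces, some p in V involves all r
variables.

Low sensitivity: the sum over i of Pr[p = 0, ∂ᵢp ≠ 0] is O(r^(3/4))
(`sum_sensitivity_zeros_quadratic_le`), so some j has Pr[p = 0, ∂ⱼp ≠ 0] ≤ η/2. Put L = ∂ⱼp, which
is affine.

Few coefficients: L then vanishes with probability above η/2, so Littlewood–Offord
(`card_mul_card_zeros_affine_le`) leaves it O(1/η²) coefficients. -/

open MvPolynomial

/-! ### Multilinear polynomials and their partial derivatives. -/

section Multilinear

variable {n d : ℕ}

lemma mem_multilinearPoly {p : MvPolynomial (Fin n) ℝ} :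
    p ∈ multilinearPoly n d ↔ ∀ s ∈ p.support, s.degree ≤ d ∧ ∀ i, s i ≤ 1 := by
  rw [multilinearPoly, Submodule.mem_inf, mem_restrictTotalDegree, mem_restrictDegree,
    totalDegree, Finset.sup_le_iff]
  exact ⟨fun h s hs => ⟨h.1 s hs, h.2 s hs⟩, fun h => ⟨fun s hs => (h s hs).1, fun s hs => (h s hs).2⟩⟩

lemma pderiv_mem_multilinearPoly {p : MvPolynomial (Fin n) ℝ} (hp : p ∈ multilinearPoly n (d + 1))
    (i : Fin n) : pderiv i p ∈ multilinearPoly n d := by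
  rw [mem_multilinearPoly] at hp ⊢
  intro s hs
  rw [mem_support_iff, coeff_pderiv] at hs
  obtain ⟨h₁, h₂⟩ := hp _ (mem_support_iff.2 (left_ne_zero_of_mul hs))
  simp only [map_add, Finsupp.degree_single, add_le_add_iff_right] at h₁
  refine ⟨h₁, fun j => le_trans ?_ (h₂ j)⟩
  simp

lemma pderiv_pderiv_self {p : MvPolynomial (Fin n) ℝ} (hp : p ∈ multilinearPoly n d)
    (i : Fin n) : pderiv i (pderiv i p) = 0 := by
  ext s
  rw [coeff_pderiv, coeff_pderiv, coeff_zero]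
  have : coeff (s + Finsupp.single i 1 + Finsupp.single i 1) p = 0 := by
    by_contra h
    have := (mem_multilinearPoly.1 hp _ (mem_support_iff.2 h)).2 i
    simp at this
  simp [this]

lemma pderiv_pderiv_comm (p : MvPolynomial (Fin n) ℝ) (i j : Fin n) :
    pderiv i (pderiv j p) = pderiv j (pderiv i p) := by
  ext s
  rcases eq_or_ne i j with rfl | hij
  · rfl
  · simp only [coeff_pderiv, Finsupp.add_apply, Finsupp.single_apply, hij, hij.symm, if_false,
      add_zero, add_right_comm s]
    ring

lemma eq_C_of_forall_pderiv_eq_zero {p : MvPolynomial (Fin n) ℝ} (hp : ∀ i, pderiv i p = 0) :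
    p = C (coeff 0 p) := by
  ext s
  rw [coeff_C]
  split_ifs with h
  · rw [← h]
  · obtain ⟨i, hi⟩ : ∃ i, s i ≠ 0 := by
      by_contra! h'
      exact h (Finsupp.ext fun i => (h' i).symm)
    have h1 := congrArg (coeff (s - Finsupp.single i 1)) (hp i)
    have hs : s - Finsupp.single i 1 + Finsupp.single i 1 = s :=
      tsub_add_cancel_of_le (by simpa [Finsupp.single_le_iff] using Nat.one_le_iff_ne_zero.2 hi)
    rw [coeff_pderiv, hs, coeff_zero] at h1
    exact (mul_eq_zero.1 h1).resolve_right (by positivity)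

lemma eq_C_of_mem_multilinearPoly_zero {p : MvPolynomial (Fin n) ℝ}
    (hp : p ∈ multilinearPoly n 0) : p = C (coeff 0 p) := by
  rw [← totalDegree_eq_zero_iff_eq_C, ← Nat.le_zero, ← mem_restrictTotalDegree]
  exact hp.1

lemma support_card_le_of_mem_multilinearPoly_one {p : MvPolynomial (Fin n) ℝ}
    (hp : p ∈ multilinearPoly n 1) :
    p.support.card ≤ (Finset.univ.filter fun i => pderiv i p ≠ 0).card + 1 := by
  classical
  have hsub : p.support ⊆ insert 0
      ((Finset.univ.filter fun i => pderiv i p ≠ 0).image fun i => Finsupp.single i 1) := by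
    intro s hs
    rw [Finset.mem_insert]
    by_cases h0 : s = 0
    · exact Or.inl h0
    right
    have hdeg : s.degree = 1 := by
      have h1 := (mem_multilinearPoly.1 hp s hs).1
      have h2 : s.degree ≠ 0 := by rwa [Ne, Finsupp.degree_eq_zero_iff]
      omega
    obtain ⟨i, rfl⟩ := (Finsupp.sum_eq_one_iff s).1 hdeg
    refine Finset.mem_image.2 ⟨i, Finset.mem_filter.2 ⟨Finset.mem_univ _, fun h => ?_⟩, rfl⟩
    have h1 := congrArg (coeff 0) h
    rw [coeff_pderiv] at h1
    simp at h1
    exact mem_support_iff.1 hs h1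
  exact (Finset.card_le_card hsub).trans ((Finset.card_insert_le _ _).trans
    (Nat.add_le_add_right Finset.card_image_le 1))

end Multilinear

/-! ### Coordinate flips and discrete derivatives on the cube. -/

section Flip

variable {n d : ℕ}

/-- Negation of the `i`-th coordinate. -/
def flipCoord (i : Fin n) (x : Fin n → ℝ) : Fin n → ℝ :=
  Function.update x i (-x i)

@[simp] lemma flipCoord_self (i : Fin n) (x : Fin n → ℝ) : flipCoord i x i = -x i := by
  simp [flipCoord]

lemma flipCoord_of_ne {i j : Fin n} (h : j ≠ i) (x : Fin n → ℝ) : flipCoord i x j = x j := by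
  simp [flipCoord, h]

@[simp] lemma flipCoord_flipCoord (i : Fin n) (x : Fin n → ℝ) :
    flipCoord i (flipCoord i x) = x := by
  simp [flipCoord]

lemma mem_boolCube {x : Fin n → ℝ} : x ∈ boolCube n ↔ ∀ i, x i = -1 ∨ x i = 1 := by
  simp [boolCube]

lemma flipCoord_mem_boolCube {i : Fin n} {x : Fin n → ℝ} (hx : x ∈ boolCube n) :
    flipCoord i x ∈ boolCube n := by
  rw [mem_boolCube] at hx ⊢
  intro j
  rcases eq_or_ne j i with rfl | h
  · rw [flipCoord_self]
    rcases hx j with h | h <;> simp [h]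
  · rw [flipCoord_of_ne h]
    exact hx j

lemma card_boolCube : (boolCube n).card = 2 ^ n := by
  have : (({-1, 1} : Finset ℝ)).card = 2 := Finset.card_pair (by norm_num)
  simp [boolCube, Fintype.card_piFinset, this]

lemma sum_boolCube_flipCoord (i : Fin n) (F : (Fin n → ℝ) → ℝ) :
    ∑ x ∈ boolCube n, F (flipCoord i x) = ∑ x ∈ boolCube n, F x :=
  Finset.sum_nbij' (flipCoord i) (flipCoord i) (fun _ hx => flipCoord_mem_boolCube hx)
    (fun _ hx => flipCoord_mem_boolCube hx) (by simp) (by simp) (by simp)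

lemma eval_monomial_sub_eval_flipCoord {s : Fin n →₀ ℕ} {i : Fin n} (hs : s i ≤ 1) (c : ℝ)
    (x : Fin n → ℝ) :
    eval x (monomial s c) - eval (flipCoord i x) (monomial s c) =
      2 * x i * eval x (pderiv i (monomial s c)) := by
  have key : ∀ t : Fin n →₀ ℕ, t i = 0 →
      (t.prod fun k e => flipCoord i x k ^ e) = t.prod fun k e => x k ^ e := by
    intro t ht
    refine Finsupp.prod_congr fun k hk => ?_
    rw [flipCoord_of_ne]
    rintro rfl
    exact Finsupp.mem_support_iff.1 hk ht
  rcases Nat.le_one_iff_eq_zero_or_eq_one.1 hs with h | h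
  · simp [pderiv_monomial, eval_monomial, h, key s h]
  · obtain ⟨t, rfl⟩ : ∃ t, s = t + Finsupp.single i 1 :=
      ⟨s - Finsupp.single i 1, (tsub_add_cancel_of_le (by simp [Finsupp.single_le_iff, h])).symm⟩
    have ht : t i = 0 := by simpa using h
    simp only [pderiv_monomial, eval_monomial, h, add_tsub_cancel_right, Nat.cast_one, mul_one]
    rw [Finsupp.prod_add_index' (by simp) (by intros; rw [pow_add]),
      Finsupp.prod_add_index' (by simp) (by intros; rw [pow_add]), key t ht]
    simp
    ring

/-- A multilinear p is affine in each coordinate, so the first-order difference is exact. -/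
lemma eval_sub_eval_flipCoord {p : MvPolynomial (Fin n) ℝ} (hp : p ∈ multilinearPoly n d)
    (i : Fin n) (x : Fin n → ℝ) :
    eval x p - eval (flipCoord i x) p = 2 * x i * eval x (pderiv i p) := by
  have h : ∀ t : Finset (Fin n →₀ ℕ), (∀ s ∈ t, s i ≤ 1) → ∀ c : (Fin n →₀ ℕ) → ℝ,
      eval x (∑ s ∈ t, monomial s (c s)) - eval (flipCoord i x) (∑ s ∈ t, monomial s (c s)) =
        2 * x i * eval x (pderiv i (∑ s ∈ t, monomial s (c s))) := by
    intro t ht c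
    simp only [map_sum, Finset.mul_sum, ← Finset.sum_sub_distrib]
    exact Finset.sum_congr rfl fun s hs => eval_monomial_sub_eval_flipCoord (ht s hs) _ _
  have := h p.support (fun s hs => (mem_multilinearPoly.1 hp s hs).2 i) fun s => coeff s p
  rwa [support_sum_monomial_coeff] at this

lemma eval_flipCoord_pderiv {p : MvPolynomial (Fin n) ℝ} (hp : p ∈ multilinearPoly n (d + 1))
    (i : Fin n) (x : Fin n → ℝ) :
    eval (flipCoord i x) (pderiv i p) = eval x (pderiv i p) := by
  have := eval_sub_eval_flipCoord (pderiv_mem_multilinearPoly hp i) i x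
  rw [pderiv_pderiv_self hp, map_zero, mul_zero] at this
  linarith

end Flip

/-! ### Average sensitivity at zeros, for quadratic and affine polynomials. -/

section Sensitivity

variable {n d : ℕ}

lemma abs_sign_le_one (u : ℝ) : |Real.sign u| ≤ 1 := by
  rcases Real.sign_apply_eq u with h | h | h <;> simp [h]

lemma abs_coord_of_mem_boolCube {x : Fin n → ℝ} (hx : x ∈ boolCube n) (i : Fin n) : |x i| = 1 := by
  rcases mem_boolCube.1 hx i with h | h <;> simp [h]

/-- The sign climbs by at least 1 for an endpoint at zero; by strictness at most one endpoint is
zero. -/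
lemma indicator_add_indicator_le_sign_sub_sign {u v : ℝ} (h : v < u) :
    (if u = 0 then 1 else 0) + (if v = 0 then (1 : ℝ) else 0) ≤ Real.sign u - Real.sign v := by
  rcases lt_trichotomy u 0 with hu | hu | hu
  · have hv := h.trans hu
    simp [Real.sign_of_neg hu, Real.sign_of_neg hv, hu.ne, hv.ne]
  · subst hu
    simp [Real.sign_of_neg h, h.ne]
  · rcases lt_trichotomy v 0 with hv | hv | hv
    · simp [Real.sign_of_pos hu, Real.sign_of_neg hv, hu.ne', hv.ne]
    · simp [Real.sign_of_pos hu, hv, hu.ne']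
    · simp [Real.sign_of_pos hu, Real.sign_of_pos hv, hu.ne', hv.ne']

lemma sum_indicator_sensitive_le {g : MvPolynomial (Fin n) ℝ} (hg : g ∈ multilinearPoly n (d + 1))
    (i : Fin n) :
    ∑ x ∈ boolCube n, (if eval x g = 0 ∧ eval x (pderiv i g) ≠ 0 then (1 : ℝ) else 0) ≤
      ∑ x ∈ boolCube n, Real.sign (eval x g) * (x i * Real.sign (eval x (pderiv i g))) := by
  -- The inequality holds on each pair {x, flip of x}: ∂ᵢg is the same at both points, and when it
  -- is nonzero, xᵢ·sign(∂ᵢg) is the direction in which g jumps.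
  have h := Finset.sum_le_sum (s := boolCube n)
    (f := fun x => (if eval x g = 0 ∧ eval x (pderiv i g) ≠ 0 then (1 : ℝ) else 0) +
      (if eval (flipCoord i x) g = 0 ∧ eval (flipCoord i x) (pderiv i g) ≠ 0 then (1 : ℝ) else 0))
    (g := fun x => Real.sign (eval x g) * (x i * Real.sign (eval x (pderiv i g))) +
      Real.sign (eval (flipCoord i x) g) *
        (flipCoord i x i * Real.sign (eval (flipCoord i x) (pderiv i g)))) (by
    intro x hx
    have h1 := eval_sub_eval_flipCoord hg i x
    simp only [eval_flipCoord_pderiv hg, flipCoord_self]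
    generalize eval x g = u at *
    generalize eval (flipCoord i x) g = v at *
    generalize eval x (pderiv i g) = D at *
    have hup : 0 < D * x i → v < u := fun h => by linarith
    have hdn : D * x i < 0 → u < v := fun h => by linarith
    rcases mem_boolCube.1 hx i with hxi | hxi <;> rcases lt_trichotomy D 0 with hD | hD | hD
    · have := indicator_add_indicator_le_sign_sub_sign (hup (by rw [hxi]; linarith))
      simpa [hD.ne, hxi, Real.sign_of_neg hD, sub_eq_add_neg] using this
    · simp [hD]
    · have := indicator_add_indicator_le_sign_sub_sign (hdn (by rw [hxi]; linarith))
      simp only [hD.ne', hxi, Real.sign_of_pos hD, ne_eq, not_false_eq_true, and_true]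
      linarith
    · have := indicator_add_indicator_le_sign_sub_sign (hdn (by rw [hxi]; linarith))
      simp only [hD.ne, hxi, Real.sign_of_neg hD, ne_eq, not_false_eq_true, and_true]
      linarith
    · simp [hD]
    · have := indicator_add_indicator_le_sign_sub_sign (hup (by rw [hxi]; linarith))
      simpa [hD.ne', hxi, Real.sign_of_pos hD, sub_eq_add_neg] using this)
  rw [Finset.sum_add_distrib, Finset.sum_add_distrib,
    sum_boolCube_flipCoord i fun x =>
      if eval x g = 0 ∧ eval x (pderiv i g) ≠ 0 then (1 : ℝ) else 0,
    sum_boolCube_flipCoord i fun x =>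
      Real.sign (eval x g) * (x i * Real.sign (eval x (pderiv i g)))] at h
  linarith

lemma sum_boolCube_coord_mul_coord {i j : Fin n} (h : i ≠ j) :
    ∑ x ∈ boolCube n, x i * x j = 0 := by
  have := sum_boolCube_flipCoord i fun x => x i * x j
  simp only [flipCoord_self, flipCoord_of_ne h.symm, neg_mul, Finset.sum_neg_distrib] at this
  linarith

lemma sum_boolCube_sq_linear_le (R : Finset (Fin n)) (c : Fin n → ℝ) (hc : ∀ j ∈ R, |c j| ≤ 1) :
    ∑ x ∈ boolCube n, (∑ j ∈ R, c j * x j) ^ 2 ≤ (boolCube n).card * R.card := by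
  calc ∑ x ∈ boolCube n, (∑ j ∈ R, c j * x j) ^ 2
      = ∑ i ∈ R, ∑ j ∈ R, c i * c j * ∑ x ∈ boolCube n, x i * x j := by
        simp_rw [sq, Finset.sum_mul_sum, Finset.mul_sum]
        rw [Finset.sum_comm]
        refine Finset.sum_congr rfl fun i _ => ?_
        rw [Finset.sum_comm]
        exact Finset.sum_congr rfl fun j _ => Finset.sum_congr rfl fun x _ => by ring
    _ = ∑ i ∈ R, c i ^ 2 * (boolCube n).card := by
        refine Finset.sum_congr rfl fun i hi => ?_
        have hsq : ∑ x ∈ boolCube n, x i * x i = (boolCube n).card := by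
          rw [Finset.sum_congr rfl fun x hx => show x i * x i = (1 : ℝ) by
            rw [← abs_mul_abs_self, abs_coord_of_mem_boolCube hx, one_mul]]
          simp
        rw [Finset.sum_eq_single_of_mem i hi fun j _ hij => by
          rw [sum_boolCube_coord_mul_coord hij.symm, mul_zero], hsq, ← sq]
    _ ≤ ∑ i ∈ R, 1 * ((boolCube n).card : ℝ) := by
        refine Finset.sum_le_sum fun i hi => mul_le_mul_of_nonneg_right ?_ (Nat.cast_nonneg _)
        rw [← sq_abs]
        exact pow_le_one₀ (abs_nonneg _) (hc i hi)
    _ = (boolCube n).card * R.card := by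
        simp [mul_comm]

/-- Cauchy–Schwarz: it removes a bounded sign factor, leaving only a second moment to estimate. -/
lemma sum_mul_le_sqrt {α : Type*} (s : Finset α) (h W : α → ℝ) (hh : ∀ x, |h x| ≤ 1) {B : ℝ}
    (hB : ∑ x ∈ s, W x ^ 2 ≤ s.card * B) :
    ∑ x ∈ s, h x * W x ≤ s.card * √B := by
  have h1 : (∑ x ∈ s, h x * W x) ^ 2 ≤ (s.card : ℝ) ^ 2 * B := by
    refine (sq_sum_le_card_mul_sum_sq).trans ?_
    rw [sq (s.card : ℝ), mul_assoc]
    refine mul_le_mul_of_nonneg_left (le_trans (Finset.sum_le_sum fun x _ => ?_) hB)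
      (Nat.cast_nonneg _)
    rw [mul_pow, ← sq_abs (h x)]
    exact mul_le_of_le_one_left (sq_nonneg _) (pow_le_one₀ (abs_nonneg _) (hh x))
  refine (Real.le_sqrt_of_sq_le h1).trans_eq ?_
  rw [Real.sqrt_mul (sq_nonneg _), Real.sqrt_sq (Nat.cast_nonneg _)]

/-- Flipping xⱼ fixes ∂ⱼg and moves ∂ᵢg monotonically, in the direction given by the constant a =
∂ⱼ∂ᵢg. With u, v the two values of ∂ᵢg, a pair contributes at most |sign u − sign v| =
sign(a)·xⱼ·(sign u − sign v). The sign of ∂ⱼg is thus replaced by a constant. -/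
lemma sum_coord_mul_coord_mul_sign_le {g : MvPolynomial (Fin n) ℝ}
    (hg : g ∈ multilinearPoly n 2) {i j : Fin n} (hij : i ≠ j) :
    ∑ x ∈ boolCube n, (x i * Real.sign (eval x (pderiv i g))) *
        (x j * Real.sign (eval x (pderiv j g))) ≤
      ∑ x ∈ boolCube n, Real.sign (eval x (pderiv i g)) *
        (Real.sign (coeff 0 (pderiv j (pderiv i g))) * x j) := by
  have h := Finset.sum_le_sum (s := boolCube n)
    (f := fun x => (x i * Real.sign (eval x (pderiv i g))) *
        (x j * Real.sign (eval x (pderiv j g))) +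
      (flipCoord j x i * Real.sign (eval (flipCoord j x) (pderiv i g))) *
        (flipCoord j x j * Real.sign (eval (flipCoord j x) (pderiv j g))))
    (g := fun x => Real.sign (eval x (pderiv i g)) *
        (Real.sign (coeff 0 (pderiv j (pderiv i g))) * x j) +
      Real.sign (eval (flipCoord j x) (pderiv i g)) *
        (Real.sign (coeff 0 (pderiv j (pderiv i g))) * flipCoord j x j)) (by
    intro x hx
    have hgi := pderiv_mem_multilinearPoly hg i
    have h1 := eval_sub_eval_flipCoord hgi j x
    rw [eq_C_of_mem_multilinearPoly_zero (pderiv_mem_multilinearPoly hgi j), eval_C] at h1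
    simp only [eval_flipCoord_pderiv hg, flipCoord_self, flipCoord_of_ne hij]
    have hG : |x i * Real.sign (eval x (pderiv j g))| ≤ 1 := by
      rw [abs_mul, abs_coord_of_mem_boolCube hx, one_mul]
      exact abs_sign_le_one _
    have hT : ∀ T : ℝ, T * (x i * Real.sign (eval x (pderiv j g))) ≤ |T| := fun T => by
      refine (le_abs_self _).trans ?_
      rw [abs_mul]
      exact mul_le_of_le_one_right (abs_nonneg _) hG
    have hx' := mem_boolCube.1 hx j
    generalize eval x (pderiv i g) = u at *
    generalize eval (flipCoord j x) (pderiv i g) = v at *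
    generalize coeff 0 (pderiv j (pderiv i g)) = a at *
    have hmono : ∀ {y z : ℝ}, y ≤ z → Real.sign y ≤ Real.sign z := by
      intro y z hyz
      rcases lt_trichotomy y 0 with hy | hy | hy <;> rcases lt_trichotomy z 0 with hz | hz | hz <;>
        simp [Real.sign_of_neg, Real.sign_of_pos, hy, hz] <;> linarith
    have hup : 0 ≤ a * x j → Real.sign v ≤ Real.sign u := fun h => hmono (by linarith)
    have hdn : a * x j ≤ 0 → Real.sign u ≤ Real.sign v := fun h => hmono (by linarith)
    have key : |x j * (Real.sign u - Real.sign v)| ≤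
        Real.sign a * (x j * (Real.sign u - Real.sign v)) := by
      rw [abs_mul, abs_coord_of_mem_boolCube hx, one_mul]
      rcases hx' with hxj | hxj <;> rcases lt_trichotomy a 0 with ha | ha | ha <;>
        simp only [Real.sign_of_neg, Real.sign_of_pos, Real.sign_zero, ha, hxj] at hup hdn ⊢
      · have := hup (by linarith)
        rw [abs_of_nonneg] <;> linarith
      · have := hup (by linarith)
        have := hdn (by linarith)
        rw [abs_of_nonneg] <;> linarith
      · have := hdn (by linarith)
        rw [abs_of_nonpos] <;> linarith
      · have := hdn (by linarith)
        rw [abs_of_nonpos] <;> linarith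
      · have := hup (by linarith)
        have := hdn (by linarith)
        rw [abs_of_nonneg] <;> linarith
      · have := hup (by linarith)
        rw [abs_of_nonneg] <;> linarith
    have := (hT (x j * (Real.sign u - Real.sign v))).trans key
    linarith)
  rw [Finset.sum_add_distrib, Finset.sum_add_distrib,
    sum_boolCube_flipCoord j fun x => (x i * Real.sign (eval x (pderiv i g))) *
        (x j * Real.sign (eval x (pderiv j g))),
    sum_boolCube_flipCoord j fun x => Real.sign (eval x (pderiv i g)) *
        (Real.sign (coeff 0 (pderiv j (pderiv i g))) * x j)] at h
  linarith

lemma sum_sq_sum_coord_mul_sign_le {g : MvPolynomial (Fin n) ℝ} (hg : g ∈ multilinearPoly n 2)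
    (R : Finset (Fin n)) :
    ∑ x ∈ boolCube n, (∑ i ∈ R, x i * Real.sign (eval x (pderiv i g))) ^ 2 ≤
      (boolCube n).card * (R.card + R.card * √R.card) := by
  calc ∑ x ∈ boolCube n, (∑ i ∈ R, x i * Real.sign (eval x (pderiv i g))) ^ 2
      = ∑ i ∈ R, ∑ j ∈ R, ∑ x ∈ boolCube n, (x i * Real.sign (eval x (pderiv i g))) *
          (x j * Real.sign (eval x (pderiv j g))) := by
        simp_rw [sq, Finset.sum_mul_sum]
        rw [Finset.sum_comm]
        exact Finset.sum_congr rfl fun i _ => Finset.sum_comm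
    -- In row i the diagonal term averages at most 1. The others together form a bounded sign times
    -- a linear form with coefficients in [-1, 1], averaging at most √|R|.
    _ ≤ ∑ i ∈ R, ((boolCube n).card + (boolCube n).card * √R.card : ℝ) := by
        refine Finset.sum_le_sum fun i hi => ?_
        rw [← Finset.add_sum_erase R _ hi]
        refine add_le_add ?_ ?_
        · refine (Finset.sum_le_card_nsmul _ _ 1 fun x hx => ?_).trans_eq (by simp)
          rw [← sq, ← sq_abs]
          refine pow_le_one₀ (abs_nonneg _) ?_
          rw [abs_mul, abs_coord_of_mem_boolCube hx, one_mul]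
          exact abs_sign_le_one _
        · calc _ ≤ ∑ j ∈ R.erase i, ∑ x ∈ boolCube n, Real.sign (eval x (pderiv i g)) *
                (Real.sign (coeff 0 (pderiv j (pderiv i g))) * x j) :=
                Finset.sum_le_sum fun j hj =>
                  sum_coord_mul_coord_mul_sign_le hg (Finset.ne_of_mem_erase hj).symm
            _ = ∑ x ∈ boolCube n, Real.sign (eval x (pderiv i g)) * ∑ j ∈ R.erase i,
                Real.sign (coeff 0 (pderiv j (pderiv i g))) * x j := by
                rw [Finset.sum_comm]
                simp_rw [Finset.mul_sum]
            _ ≤ (boolCube n).card * √(R.erase i).card :=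
                sum_mul_le_sqrt _ _ _ (fun x => abs_sign_le_one _)
                  (sum_boolCube_sq_linear_le _ _ fun j _ => abs_sign_le_one _)
            _ ≤ _ := by
                gcongr
                exact Finset.erase_subset _ _
    _ = _ := by
        rw [Finset.sum_const, nsmul_eq_mul]
        ring

lemma sum_indicator_le_sum_sign_mul {g : MvPolynomial (Fin n) ℝ}
    (hg : g ∈ multilinearPoly n (d + 1)) (R : Finset (Fin n)) :
    ∑ i ∈ R, ∑ x ∈ boolCube n,
        (if eval x g = 0 ∧ eval x (pderiv i g) ≠ 0 then (1 : ℝ) else 0) ≤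
      ∑ x ∈ boolCube n, Real.sign (eval x g) *
        ∑ i ∈ R, x i * Real.sign (eval x (pderiv i g)) := by
  simp_rw [Finset.mul_sum]
  rw [Finset.sum_comm (s := boolCube n)]
  exact Finset.sum_le_sum fun i _ => sum_indicator_sensitive_le hg i

/-- A quadratic polynomial has average sensitivity `O(r ^ (3 / 4))` at its zeros. -/
lemma sum_sensitivity_zeros_quadratic_le {g : MvPolynomial (Fin n) ℝ}
    (hg : g ∈ multilinearPoly n 2) (R : Finset (Fin n)) :
    ∑ i ∈ R, ∑ x ∈ boolCube n,
        (if eval x g = 0 ∧ eval x (pderiv i g) ≠ 0 then (1 : ℝ) else 0) ≤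
      (boolCube n).card * √(R.card + R.card * √R.card) :=
  (sum_indicator_le_sum_sign_mul hg R).trans
    (sum_mul_le_sqrt _ _ _ (fun _ => abs_sign_le_one _) (sum_sq_sum_coord_mul_sign_le hg R))

/-- The Erdős–Littlewood–Offord bound for the zeros of an affine form. -/
lemma card_mul_card_zeros_affine_le {L : MvPolynomial (Fin n) ℝ} (hL : L ∈ multilinearPoly n 1)
    (R : Finset (Fin n)) (hR : ∀ i ∈ R, pderiv i L ≠ 0) :
    (R.card : ℝ) * ((boolCube n).filter fun x => eval x L = 0).card ≤
      (boolCube n).card * √R.card := by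
  have hc : ∀ i, pderiv i L = C (coeff 0 (pderiv i L)) := fun i =>
    eq_C_of_mem_multilinearPoly_zero (pderiv_mem_multilinearPoly hL i)
  have hev : ∀ i x, eval x (pderiv i L) = coeff 0 (pderiv i L) := fun i x => by
    rw [hc i, eval_C, coeff_C, if_pos rfl]
  have h1 := sum_indicator_le_sum_sign_mul hL R
  have h2 : ∑ i ∈ R, ∑ x ∈ boolCube n,
        (if eval x L = 0 ∧ eval x (pderiv i L) ≠ 0 then (1 : ℝ) else 0) =
      (R.card : ℝ) * ((boolCube n).filter fun x => eval x L = 0).card := by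
    rw [← nsmul_eq_mul, ← Finset.sum_const]
    refine Finset.sum_congr rfl fun i hi => ?_
    have : coeff 0 (pderiv i L) ≠ 0 := fun h => hR i hi (by rw [hc i, h, C_0])
    simp [hev, this]
  rw [h2] at h1
  -- The derivatives are constant here, so orthogonality of the coordinates bounds the second moment
  -- by |R|, without the extra |R|^(3/2).
  refine h1.trans (sum_mul_le_sqrt _ _ _ (fun _ => abs_sign_le_one _) ?_)
  simp_rw [hev, mul_comm _ (Real.sign (coeff _ _))]
  exact sum_boolCube_sq_linear_le R _ fun j _ => abs_sign_le_one _

end Sensitivity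

/-! ### Dimension of spaces vanishing on a subset of the cube. -/

section Dimension

variable {n d : ℕ}

/-- Used with f = ∂ⱼ, to split V into the part free of xⱼ and the space of derivatives ∂ⱼV. -/
lemma finrank_inf_ker_add_finrank_map {E F : Type*} [AddCommGroup E] [Module ℝ E]
    [AddCommGroup F] [Module ℝ F] (f : E →ₗ[ℝ] F) (V : Submodule ℝ E) [FiniteDimensional ℝ V] :
    Module.finrank ℝ ↥(V ⊓ LinearMap.ker f) + Module.finrank ℝ ↥(V.map f) =
      Module.finrank ℝ V := by
  have h := LinearMap.finrank_range_add_finrank_ker (f.domRestrict V)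
  rw [LinearMap.range_domRestrict, LinearMap.ker_domRestrict] at h
  rw [← h, add_comm, ← Submodule.map_comap_subtype, Submodule.finrank_map_subtype_eq]

lemma finrank_le_one_of_forall_pderiv_eq_zero {V : Submodule ℝ (MvPolynomial (Fin n) ℝ)}
    (hV : ∀ p ∈ V, ∀ i, pderiv i p = 0) : Module.finrank ℝ V ≤ 1 := by
  have hle : V ≤ Submodule.span ℝ {1} := fun p hp => by
    rw [Submodule.mem_span_singleton]
    exact ⟨coeff 0 p, by rw [smul_eq_C_mul, mul_one, ← eq_C_of_forall_pderiv_eq_zero (hV p hp)]⟩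
  exact (Submodule.finrank_mono hle).trans
    ((finrank_span_le_card _).trans (by simp))

lemma eq_bot_of_forall_pderiv_eq_zero {V : Submodule ℝ (MvPolynomial (Fin n) ℝ)}
    (hV : ∀ p ∈ V, ∀ i, pderiv i p = 0) {x : Fin n → ℝ} (hx : ∀ p ∈ V, eval x p = 0) :
    V = ⊥ := by
  rw [Submodule.eq_bot_iff]
  intro p hp
  have h := eq_C_of_forall_pderiv_eq_zero (hV p hp)
  have h0 := hx p hp
  rw [h, eval_C] at h0
  rw [h, h0, C_0]

lemma finrank_affine_le_card_add_one (S : Finset (Fin n))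
    (V : Submodule ℝ (MvPolynomial (Fin n) ℝ)) [FiniteDimensional ℝ V]
    (hV : V ≤ multilinearPoly n 1) (hS : ∀ p ∈ V, ∀ i ∉ S, pderiv i p = 0) :
    Module.finrank ℝ V ≤ S.card + 1 := by
  induction S using Finset.induction_on generalizing V with
  | empty => exact finrank_le_one_of_forall_pderiv_eq_zero fun p hp i => hS p hp i (by simp)
  | insert j S hj ih =>
    rw [← finrank_inf_ker_add_finrank_map (pderiv j).toLinearMap V, Finset.card_insert_of_notMem hj]
    refine add_le_add (ih _ (inf_le_left.trans hV) fun p hp i hi => ?_)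
      (finrank_le_one_of_forall_pderiv_eq_zero ?_)
    · rcases eq_or_ne i j with rfl | hij
      · exact hp.2
      · exact hS p hp.1 i (by simp [hij, hi])
    · rintro _ ⟨p, hp, rfl⟩ i
      change pderiv i (pderiv j p) = 0
      rw [eq_C_of_mem_multilinearPoly_zero (pderiv_mem_multilinearPoly (hV hp) j), pderiv_C]

lemma mem_image_flipCoord [DecidableEq (Fin n → ℝ)] {Z : Finset (Fin n → ℝ)} {j : Fin n}
    {x : Fin n → ℝ} : x ∈ Z.image (flipCoord j) ↔ flipCoord j x ∈ Z := by
  rw [Finset.mem_image]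
  constructor
  · rintro ⟨y, hy, rfl⟩
    simpa using hy
  · exact fun h => ⟨_, h, by simp⟩

lemma card_image_flipCoord [DecidableEq (Fin n → ℝ)] (Z : Finset (Fin n → ℝ)) (j : Fin n) :
    (Z.image (flipCoord j)).card = Z.card :=
  Finset.card_image_of_injective _
    (Function.LeftInverse.injective (g := flipCoord j) fun x => by simp)

lemma image_flipCoord_subset [DecidableEq (Fin n → ℝ)] {Z : Finset (Fin n → ℝ)}
    (hZ : Z ⊆ boolCube n) (j : Fin n) : Z.image (flipCoord j) ⊆ boolCube n := by
  intro x hx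
  simpa using flipCoord_mem_boolCube (i := j) (hZ (mem_image_flipCoord.1 hx))

lemma eval_eq_zero_of_mem_union_image_flipCoord [DecidableEq (Fin n → ℝ)]
    {Z : Finset (Fin n → ℝ)} {j : Fin n} {p : MvPolynomial (Fin n) ℝ}
    (hp : p ∈ multilinearPoly n d) (hj : pderiv j p = 0) (hZ : ∀ x ∈ Z, eval x p = 0)
    {x : Fin n → ℝ} (hx : x ∈ Z ∪ Z.image (flipCoord j)) : eval x p = 0 := by
  rcases Finset.mem_union.1 hx with h | h
  · exact hZ x h
  · have h1 := eval_sub_eval_flipCoord hp j x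
    rw [hZ _ (mem_image_flipCoord.1 h), hj, map_zero, mul_zero, sub_zero] at h1
    exact h1

/-- The difference of p across the flip is 2xⱼ∂ⱼp, and xⱼ ≠ 0 on the cube. -/
lemma eval_pderiv_eq_zero_of_mem_inter_image_flipCoord [DecidableEq (Fin n → ℝ)]
    {Z : Finset (Fin n → ℝ)} (hZc : Z ⊆ boolCube n) {j : Fin n} {p : MvPolynomial (Fin n) ℝ}
    (hp : p ∈ multilinearPoly n d) (hZ : ∀ x ∈ Z, eval x p = 0)
    {x : Fin n → ℝ} (hx : x ∈ Z ∩ Z.image (flipCoord j)) : eval x (pderiv j p) = 0 := by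
  rw [Finset.mem_inter, mem_image_flipCoord] at hx
  have h1 := eval_sub_eval_flipCoord hp j x
  rw [hZ _ hx.1, hZ _ hx.2, sub_zero, eq_comm, mul_assoc, mul_eq_zero_iff_left two_ne_zero] at h1
  refine (mul_eq_zero.1 h1).resolve_left fun h => ?_
  have := abs_coord_of_mem_boolCube (hZc hx.1) j
  simp [h] at this

/-- Odlyzko's bound: `k` independent affine forms have at most `2 ^ (n - k)` common zeros in the
cube. -/
lemma card_mul_two_pow_finrank_affine_le (S : Finset (Fin n))
    (V : Submodule ℝ (MvPolynomial (Fin n) ℝ)) [FiniteDimensional ℝ V]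
    (hV : V ≤ multilinearPoly n 1) (hS : ∀ p ∈ V, ∀ i ∉ S, pderiv i p = 0)
    (Y : Finset (Fin n → ℝ)) (hYc : Y ⊆ boolCube n) (hY : ∀ p ∈ V, ∀ x ∈ Y, eval x p = 0) :
    Y.card * 2 ^ Module.finrank ℝ V ≤ (boolCube n).card := by
  classical
  induction S using Finset.induction_on generalizing V Y with
  | empty =>
    rcases Y.eq_empty_or_nonempty with rfl | ⟨x, hx⟩
    · simp
    · rw [eq_bot_of_forall_pderiv_eq_zero (fun p hp i => hS p hp i (by simp))
        (fun p hp => hY p hp x hx), finrank_bot, pow_zero, mul_one]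
      exact Finset.card_le_card hYc
  | insert j S hj ih =>
    have hsum := finrank_inf_ker_add_finrank_map (pderiv j).toLinearMap V
    have hS' : ∀ p ∈ V ⊓ LinearMap.ker (pderiv j).toLinearMap, ∀ i ∉ S, pderiv i p = 0 := by
      intro p hp i hi
      rcases eq_or_ne i j with rfl | hij
      · exact hp.2
      · exact hS p hp.1 i (by simp [hij, hi])
    have hconst : ∀ p ∈ V, pderiv j p = C (coeff 0 (pderiv j p)) := fun p hp =>
      eq_C_of_mem_multilinearPoly_zero (pderiv_mem_multilinearPoly (hV hp) j)
    have hW : Module.finrank ℝ ↥(V.map (pderiv j).toLinearMap) ≤ 1 := by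
      apply finrank_le_one_of_forall_pderiv_eq_zero
      rintro _ ⟨p, hp, rfl⟩ i
      change pderiv i (pderiv j p) = 0
      rw [hconst p hp, pderiv_C]
    by_cases hbot : ∀ p ∈ V, pderiv j p = 0
    · rw [← inf_eq_left.2 (show V ≤ LinearMap.ker (pderiv j).toLinearMap from hbot)]
      exact ih _ (inf_le_left.trans hV) hS' Y hYc fun p hp => hY p hp.1
    · push Not at hbot
      obtain ⟨p, hp, hpj⟩ := hbot
      -- ∂ⱼp is a nonzero constant, so no zero of p survives the flip. Removing xⱼ therefore doubles
      -- the zero set while the dimension drops by at most one.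
      have hdisj : Y ∩ Y.image (flipCoord j) = ∅ := by
        rw [Finset.eq_empty_iff_forall_notMem]
        intro x hx
        have := eval_pderiv_eq_zero_of_mem_inter_image_flipCoord hYc (hV hp) (hY p hp) hx
        rw [hconst p hp, eval_C] at this
        exact hpj (by rw [hconst p hp, this, C_0])
      have hcard := Finset.card_union_add_card_inter Y (Y.image (flipCoord j))
      rw [hdisj, Finset.card_empty, card_image_flipCoord, add_zero] at hcard
      have h1 := ih _ (inf_le_left.trans hV) hS' (Y ∪ Y.image (flipCoord j))
        (Finset.union_subset hYc (image_flipCoord_subset hYc j)) fun q hq x hx =>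
          eval_eq_zero_of_mem_union_image_flipCoord (hV hq.1) hq.2 (hY q hq.1) hx
      rw [hcard] at h1
      refine le_trans ?_ h1
      rw [← hsum, ← two_mul, mul_comm 2, mul_assoc, ← pow_succ']
      exact Nat.mul_le_mul_left _ (Nat.pow_le_pow_right (by norm_num) (by omega))

/-- A space of quadratics in few variables that vanishes on a large part of the cube has small
dimension. -/
lemma finrank_quadratic_le {η : ℝ} (hη : 0 < η) {r : ℕ} (S : Finset (Fin n)) (hr : S.card ≤ r)
    (V : Submodule ℝ (MvPolynomial (Fin n) ℝ)) [FiniteDimensional ℝ V]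
    (hV : V ≤ multilinearPoly n 2) (hS : ∀ p ∈ V, ∀ i ∉ S, pderiv i p = 0)
    (Z : Finset (Fin n → ℝ)) (hZc : Z ⊆ boolCube n) (hZ : ∀ p ∈ V, ∀ x ∈ Z, eval x p = 0)
    (hZη : η * (boolCube n).card ≤ Z.card) :
    (Module.finrank ℝ V : ℝ) ≤
      S.card * (2 / η) + (r + 1) * (2 / η) * (1 - Z.card / (boolCube n).card) := by
  classical
  have hM : (0 : ℝ) < (boolCube n).card := by rw [card_boolCube]; positivity
  -- r stays fixed while S, V and Z vary. The term (r + 1)(2/η)(1 − density of Z) is a potential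
  -- that pays for the steps with large ∂ⱼV.
  induction S using Finset.induction_on generalizing V Z with
  | empty =>
    have hpos : (0 : ℝ) < Z.card := (by positivity : 0 < η * (boolCube n).card).trans_le hZη
    obtain ⟨x, hx⟩ := Finset.card_pos.1 (Nat.cast_pos.1 hpos)
    rw [eq_bot_of_forall_pderiv_eq_zero (fun p hp i => hS p hp i (by simp))
        (fun p hp => hZ p hp x hx), finrank_bot]
    have : (Z.card : ℝ) / (boolCube n).card ≤ 1 :=
      div_le_one_of_le₀ (by exact_mod_cast Finset.card_le_card hZc) hM.le
    have : (0 : ℝ) ≤ 1 - Z.card / (boolCube n).card := by linarith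
    simp only [Nat.cast_zero, Finset.card_empty, zero_mul, zero_add]
    positivity
  | insert j S hj ih =>
    have hsum := finrank_inf_ker_add_finrank_map (pderiv j).toLinearMap V
    rw [Finset.card_insert_of_notMem hj] at hr ⊢
    have hS' : ∀ p ∈ V ⊓ LinearMap.ker (pderiv j).toLinearMap, ∀ i ∉ S, pderiv i p = 0 := by
      intro p hp i hi
      rcases eq_or_ne i j with rfl | hij
      · exact hp.2
      · exact hS p hp.1 i (by simp [hij, hi])
    have hWV : V.map (pderiv j).toLinearMap ≤ multilinearPoly n 1 := by
      rintro _ ⟨p, hp, rfl⟩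
      exact pderiv_mem_multilinearPoly (hV hp) j
    have hWS : ∀ q ∈ V.map (pderiv j).toLinearMap, ∀ i ∉ S, pderiv i q = 0 := by
      rintro _ ⟨p, hp, rfl⟩ i hi
      change pderiv i (pderiv j p) = 0
      rcases eq_or_ne i j with rfl | hij
      · exact pderiv_pderiv_self (hV hp) i
      · rw [pderiv_pderiv_comm, hS p hp i (by simp [hij, hi]), map_zero]
    have hWY : ∀ q ∈ V.map (pderiv j).toLinearMap, ∀ x ∈ Z ∩ Z.image (flipCoord j),
        eval x q = 0 := by
      rintro _ ⟨p, hp, rfl⟩ x hx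
      exact eval_pderiv_eq_zero_of_mem_inter_image_flipCoord hZc (hV hp) (hZ p hp) hx
    have hcard := Finset.card_union_add_card_inter Z (Z.image (flipCoord j))
    rw [card_image_flipCoord] at hcard
    have hcardZ : (Z.card : ℝ) ≤ (Z ∪ Z.image (flipCoord j)).card := by
      exact_mod_cast Finset.card_le_card Finset.subset_union_left
    have h1 := ih (by omega) _ (inf_le_left.trans hV) hS' (Z ∪ Z.image (flipCoord j))
      (Finset.union_subset hZc (image_flipCoord_subset hZc j)) (fun q hq x hx =>
          eval_eq_zero_of_mem_union_image_flipCoord (hV hq.1) hq.2 (hZ q hq.1) hx)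
      (hZη.trans hcardZ)
    have hO := card_mul_two_pow_finrank_affine_le S _ hWV hWS _
      (Finset.inter_subset_left.trans hZc) hWY
    have hA := finrank_affine_le_card_add_one S _ hWV hWS
    have hsum' := congrArg (Nat.cast (R := ℝ)) hsum
    have hcard' := congrArg (Nat.cast (R := ℝ)) hcard
    push_cast at hsum' hcard' ⊢
    generalize Module.finrank ℝ ↥(V.map (pderiv j).toLinearMap) = w at *
    generalize (Z ∩ Z.image (flipCoord j)).card = y at *
    generalize (Z ∪ Z.image (flipCoord j)).card = u at *
    generalize (boolCube n).card = M at *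
    have hr1 : (0 : ℝ) < (r + 1) * (2 / η) := by positivity
    -- ∂ⱼV vanishes on Z ∩ flip Z. If that set has density at least η/2, Odlyzko's bound gives dim
    -- ∂ⱼV ≤ 2/η, charged to the variable j. If not, Z ∪ flip Z is denser than Z by at least η/2,
    -- and the potential drops by r + 1 ≥ dim ∂ⱼV.
    by_cases hy : η / 2 * M ≤ y
    · have hw : (w : ℝ) ≤ 2 / η := by
        have h2 : (y : ℝ) * 2 ^ w ≤ M := by exact_mod_cast hO
        have h3 : (w : ℝ) ≤ 2 ^ w := by exact_mod_cast Nat.lt_two_pow_self.le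
        rw [le_div_iff₀ hη]
        have h4 : η / 2 * M * w ≤ M :=
          (mul_le_mul hy h3 (Nat.cast_nonneg _) (Nat.cast_nonneg _)).trans h2
        have h5 : M * (w * η) ≤ M * (2 : ℝ) := by linarith
        exact le_of_mul_le_mul_left h5 hM
      have : (r + 1) * (2 / η) * (1 - (u : ℝ) / M) ≤ (r + 1) * (2 / η) * (1 - (Z.card : ℝ) / M) := by
        gcongr
      linarith
    · have hw : (w : ℝ) ≤ r + 1 := by exact_mod_cast (by omega : w ≤ r + 1)
      have hu : (Z.card : ℝ) / M + η / 2 ≤ u / M := by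
        rw [le_div_iff₀ hM, add_mul, div_mul_cancel₀ _ hM.ne']
        linarith
      have h2 : (r + 1) * (2 / η) * (1 - (u : ℝ) / M) ≤
          (r + 1) * (2 / η) * (1 - (Z.card : ℝ) / M) - (r + 1) * (2 / η) * (η / 2) := by
        rw [← mul_sub]
        exact mul_le_mul_of_nonneg_left (by linarith) hr1.le
      have h3 : (r + 1) * (2 / η) * (η / 2) = (r + 1 : ℝ) := by
        field_simp
      have : 0 < 2 / η := by positivity
      linarith

/-- Otherwise the kernels of the ∂ⱼ, j ∈ R, would cover V, and one of them would be all of V. -/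
lemma exists_forall_pderiv_ne_zero (V : Submodule ℝ (MvPolynomial (Fin n) ℝ))
    (R : Finset (Fin n)) (hR : ∀ j ∈ R, ∃ p ∈ V, pderiv j p ≠ 0) :
    ∃ p ∈ V, ∀ j ∈ R, pderiv j p ≠ 0 := by
  by_contra! h
  have hcov : ⋃ j : R, ((LinearMap.ker ((pderiv (j : Fin n)).toLinearMap.domRestrict V) :
      Submodule ℝ V) : Set V) = Set.univ := by
    rw [Set.eq_univ_iff_forall]
    intro p
    obtain ⟨j, hj, hpj⟩ := h p p.2
    exact Set.mem_iUnion.2 ⟨⟨j, hj⟩, hpj⟩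
  obtain ⟨j, hj⟩ := Subspace.exists_eq_top_of_iUnion_eq_univ hcov
  obtain ⟨p, hp, hpj⟩ := hR j j.2
  have : (⟨p, hp⟩ : V) ∈ LinearMap.ker ((pderiv (j : Fin n)).toLinearMap.domRestrict V) := by
    rw [hj]
    trivial
  exact hpj this

end Dimension

/-! ### Choice of constants and the main theorem. -/

section Main

variable {n : ℕ}

/-- A quadratic polynomial depending on all of `R`, with `R` large, has a partial derivative that
vanishes at almost all zeros of the polynomial. -/
lemma exists_card_zeros_pderiv_ne_zero_le {η : ℝ} (hη : 0 < η) (hη1 : η < 1)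
    {g : MvPolynomial (Fin n) ℝ} (hg : g ∈ multilinearPoly n 2) (R : Finset (Fin n))
    (hR : 64 / η ^ 4 ≤ R.card) :
    ∃ j ∈ R, (((boolCube n).filter fun x => eval x g = 0 ∧ eval x (pderiv j g) ≠ 0).card : ℝ) ≤
      η / 2 * (boolCube n).card := by
  have hr0 : (0 : ℝ) < R.card := (by positivity : 0 < 64 / η ^ 4).trans_le hR
  have hne : R.Nonempty := Finset.card_pos.1 (Nat.cast_pos.1 hr0)
  have hM : (0 : ℝ) ≤ (boolCube n).card := Nat.cast_nonneg _
  have hsq : 8 / η ^ 2 ≤ √R.card := by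
    refine Real.le_sqrt_of_sq_le (le_trans (le_of_eq ?_) hR)
    rw [div_pow]
    norm_num
    ring
  have hs2 : √(R.card : ℝ) ^ 2 = R.card := Real.sq_sqrt hr0.le
  -- With t = √|R| this is t² + t³ ≤ t⁴η²/4, which follows from t ≥ 1 and tη² ≥ 8; hence 64 = 8².
  have hbound : √((R.card : ℝ) + R.card * √R.card) ≤ R.card * (η / 2) := by
    rw [Real.sqrt_le_left (by positivity), ← hs2]
    rw [Real.sqrt_sq (Real.sqrt_nonneg _)]
    generalize √(R.card : ℝ) = t at *
    have h8 : 8 ≤ t * η ^ 2 := (div_le_iff₀ (by positivity)).1 hsq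
    have ht1 : 1 ≤ t := by
      have : (8 : ℝ) ≤ 8 / η ^ 2 := by
        rw [le_div_iff₀ (by positivity)]
        have : η ^ 2 ≤ 1 := pow_le_one₀ hη.le hη1.le
        linarith
      linarith
    have h9 : t ^ 3 * 8 ≤ t ^ 3 * (t * η ^ 2) := mul_le_mul_of_nonneg_left h8 (by positivity)
    have h10 : t ^ 2 * 1 ≤ t ^ 2 * t := mul_le_mul_of_nonneg_left ht1 (by positivity)
    nlinarith
  refine Finset.exists_le_of_sum_le hne (?_ : ∑ j ∈ R, _ ≤ ∑ j ∈ R, _)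
  have h := sum_sensitivity_zeros_quadratic_le hg R
  rw [Finset.sum_const, nsmul_eq_mul]
  refine le_trans (le_of_eq ?_) (h.trans ((mul_le_mul_of_nonneg_left hbound hM).trans_eq (by ring)))
  exact Finset.sum_congr rfl fun i _ => by simp

lemma card_zeros_affine_le {η : ℝ} (hη : 0 < η) {L : MvPolynomial (Fin n) ℝ}
    (hL : L ∈ multilinearPoly n 1) {k : ℕ} (hk : k < L.support.card) (hkη : 4 / η ^ 2 ≤ k) :
    (((boolCube n).filter fun x => eval x L = 0).card : ℝ) ≤ η / 2 * (boolCube n).card := by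
  have h := card_mul_card_zeros_affine_le hL (Finset.univ.filter fun i => pderiv i L ≠ 0)
    fun i hi => (Finset.mem_filter.1 hi).2
  -- The support may include the constant term; the strict inequality in `hk` absorbs it.
  have hcard : k ≤ (Finset.univ.filter fun i => pderiv i L ≠ 0).card := by
    have := support_card_le_of_mem_multilinearPoly_one hL
    omega
  have hK : 4 / η ^ 2 ≤ ((Finset.univ.filter fun i => pderiv i L ≠ 0).card : ℝ) :=
    hkη.trans (by exact_mod_cast hcard)
  generalize ((Finset.univ.filter fun i => pderiv i L ≠ 0).card : ℝ) = K at *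
  generalize (((boolCube n).filter fun x => eval x L = 0).card : ℝ) = z at *
  have hK0 : 0 < K := (by positivity : 0 < 4 / η ^ 2).trans_le hK
  have hs : 2 / η ≤ √K := by
    refine Real.le_sqrt_of_sq_le (le_trans (le_of_eq ?_) hK)
    rw [div_pow]
    norm_num
  have hs0 : 0 < √K := Real.sqrt_pos.2 hK0
  have h1 : z * √K ≤ (boolCube n).card := by
    refine le_of_mul_le_mul_right ?_ hs0
    rw [mul_assoc, Real.mul_self_sqrt hK0.le]
    linarith
  have h2 : 1 ≤ η / 2 * √K := by
    rw [div_le_iff₀ hη] at hs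
    linarith
  have hM : (0 : ℝ) ≤ (boolCube n).card := Nat.cast_nonneg _
  refine le_of_mul_le_mul_right (h1.trans ?_) hs0
  nlinarith

open Classical in
lemma cubeProb_le_iff {E : Set (Fin n → ℝ)} {η : ℝ} :
    cubeProb n E ≤ η ↔ (((boolCube n).filter fun x => x ∈ E).card : ℝ) ≤ η * (boolCube n).card := by
  rw [cubeProb, div_le_iff₀ (by rw [card_boolCube]; positivity)]

lemma isTheta_ceil_div_pow {c : ℝ} (hc : 0 < c) (k : ℕ) :
    Asymptotics.IsTheta (Filter.principal (Set.Ioo (0 : ℝ) 1))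
      (fun η => ((⌈c / η ^ k⌉₊ : ℕ) : ℝ)) (fun η => 1 / η ^ k) := by
  constructor
  · refine Asymptotics.isBigO_principal.2 ⟨c + 1, fun η hη => ?_⟩
    have hpos : 0 < η ^ k := pow_pos hη.1 k
    have h1 : 1 ≤ 1 / η ^ k := by
      rw [le_div_iff₀ hpos, one_mul]
      exact pow_le_one₀ hη.1.le hη.2.le
    rw [Real.norm_of_nonneg (Nat.cast_nonneg _), Real.norm_of_nonneg (by positivity)]
    refine (Nat.ceil_lt_add_one (by positivity)).le.trans ?_
    rw [add_mul, mul_one_div]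
    linarith
  · refine Asymptotics.isBigO_principal.2 ⟨1 / c, fun η hη => ?_⟩
    have hpos : 0 < η ^ k := pow_pos hη.1 k
    rw [Real.norm_of_nonneg (Nat.cast_nonneg _), Real.norm_of_nonneg (by positivity)]
    refine le_trans (le_of_eq ?_)
      (mul_le_mul_of_nonneg_left (Nat.le_ceil (c / η ^ k)) (by positivity))
    field_simp

theorem mainTheorem3 :
    ∃ N₀ N₁ : ℝ → ℕ,
      -- `Θ` with constants uniform over all `0 < η < 1`
      Asymptotics.IsTheta (Filter.principal (Set.Ioo (0 : ℝ) 1))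
        (fun η => (N₀ η : ℝ)) (fun η => 1 / η ^ 3) ∧
      Asymptotics.IsTheta (Filter.principal (Set.Ioo (0 : ℝ) 1))
        (fun η => (N₁ η : ℝ)) (fun η => 1 / η ^ 7) ∧
      ∀ η : ℝ, 0 < η → η < 1 →
        0 < N₀ η ∧ 0 < N₁ η ∧
        ∀ (n : ℕ) (V : Submodule ℝ (MvPolynomial (Fin n) ℝ)),
          V ≤ multilinearPoly n 2 → N₁ η < Module.finrank ℝ V →
          -- `totalDegree = 1`: `L` is an affine linear function that is not constant;
          -- `L.support` is the set of monomials with non-zero coefficient, including the constant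
          ∃ L : MvPolynomial (Fin n) ℝ, L.totalDegree = 1 ∧ L.support.card ≤ N₀ η ∧
            cubeProb n {x | x ∈ cubeZeros V ∧ MvPolynomial.eval x L ≠ 0} ≤ η := by
  classical
  -- The exponents leave slack: the argument needs only orders 1/η² and 1/η⁵.
  refine ⟨fun η => ⌈4 / η ^ 3⌉₊, fun η => ⌈400 / η ^ 7⌉₊, isTheta_ceil_div_pow (by norm_num) 3,
    isTheta_ceil_div_pow (by norm_num) 7, fun η hη hη1 => ⟨Nat.ceil_pos.2 (by positivity),
    Nat.ceil_pos.2 (by positivity), fun n V hV hdim => ?_⟩⟩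
  have hdim' : 400 / η ^ 7 < (Module.finrank ℝ V : ℝ) :=
    (Nat.le_ceil _).trans_lt (by exact_mod_cast hdim)
  have hdim₁ : ⌈400 / η ^ 7⌉₊ < Module.finrank ℝ V := hdim
  have hN₁ : 0 < ⌈400 / η ^ 7⌉₊ := Nat.ceil_pos.2 (by positivity)
  have hN₀ : 0 < ⌈4 / η ^ 3⌉₊ := Nat.ceil_pos.2 (by positivity)
  have : FiniteDimensional ℝ V := Module.finite_of_finrank_pos (hN₁.trans hdim)
  have hM : (0 : ℝ) < (boolCube n).card := by rw [card_boolCube]; positivity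
  set R : Finset (Fin n) := Finset.univ.filter fun j => ∃ p ∈ V, pderiv j p ≠ 0 with hRdef
  have hR : ∀ p ∈ V, ∀ i ∉ R, pderiv i p = 0 := by
    intro p hp i hi
    by_contra h
    exact hi (Finset.mem_filter.2 ⟨Finset.mem_univ _, p, hp, h⟩)
  set Z : Finset (Fin n → ℝ) := (boolCube n).filter fun x => x ∈ cubeZeros V with hZdef
  have hZV : ∀ x ∈ Z, ∀ p ∈ V, eval x p = 0 := fun x hx => (Finset.mem_filter.1 hx).2.2
  by_cases hZ : (Z.card : ℝ) ≤ η * (boolCube n).card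
  · obtain ⟨j, -⟩ : R.Nonempty := by
      rw [Finset.nonempty_iff_ne_empty]
      intro hempty
      have := finrank_le_one_of_forall_pderiv_eq_zero (V := V)
        fun p hp i => hR p hp i (by simp [hempty])
      omega
    refine ⟨X j, totalDegree_X j, ?_, cubeProb_le_iff.2 (le_trans ?_ hZ)⟩
    · rw [support_X, Finset.card_singleton]
      exact hN₀
    · exact_mod_cast Finset.card_le_card fun x hx => by
        rw [Finset.mem_filter] at hx ⊢
        exact ⟨hx.1, hx.2.1⟩
  push Not at hZ
  have hfin := finrank_quadratic_le hη R le_rfl V hV hR Z (Finset.filter_subset _ _)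
    (fun p hp x hx => hZV x hx p hp) hZ.le
  have hRcard : 64 / η ^ 4 ≤ R.card := by
    have h1 : ((R.card : ℝ) + 1) * (2 / η) * (1 - Z.card / (boolCube n).card) ≤
        (R.card + 1) * (2 / η) :=
      mul_le_of_le_one_right (by positivity) (sub_le_self _ (by positivity))
    have h2 : 400 / η ^ 7 < (2 * R.card + 1) * (2 / η) := by linarith
    have h3 : 200 / η ^ 6 < 2 * R.card + 1 := by
      rw [← mul_lt_mul_iff_left₀ (by positivity : 0 < 2 / η)]
      refine lt_of_eq_of_lt ?_ h2
      field_simp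
      norm_num
    have h4 : 200 / η ^ 4 ≤ 200 / η ^ 6 :=
      div_le_div_of_nonneg_left (by norm_num) (by positivity)
        (pow_le_pow_of_le_one hη.le hη1.le (by norm_num))
    have h5 : 1 ≤ 1 / η ^ 4 := by
      rw [le_div_iff₀ (by positivity), one_mul]
      exact pow_le_one₀ hη.le hη1.le
    have h6 : 200 / η ^ 4 = 200 * (1 / η ^ 4) := by ring
    have h7 : 64 / η ^ 4 = 64 * (1 / η ^ 4) := by ring
    linarith
  obtain ⟨p, hp, hpR⟩ := exists_forall_pderiv_ne_zero V R fun j hj => (Finset.mem_filter.1 hj).2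
  obtain ⟨j, hj, hjle⟩ := exists_card_zeros_pderiv_ne_zero_le hη hη1 (hV hp) R hRcard
  have hL := pderiv_mem_multilinearPoly (hV hp) j
  have hsens : (((boolCube n).filter fun x => x ∈ cubeZeros V ∧ eval x (pderiv j p) ≠ 0).card : ℝ) ≤
      η / 2 * (boolCube n).card := by
    refine le_trans ?_ hjle
    exact_mod_cast Finset.card_le_card fun x hx => by
      rw [Finset.mem_filter] at hx ⊢
      exact ⟨hx.1, hx.2.1.2 p hp, hx.2.2⟩
  -- Z has density above η, and at most η/2 of it lies off the zeros of ∂ⱼp.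
  have hzero : η / 2 * (boolCube n).card <
      ((boolCube n).filter fun x => eval x (pderiv j p) = 0).card := by
    have hsplit : Z ⊆ ((boolCube n).filter fun x => x ∈ cubeZeros V ∧ eval x (pderiv j p) ≠ 0) ∪
        (boolCube n).filter fun x => eval x (pderiv j p) = 0 := by
      intro x hx
      rw [Finset.mem_union, Finset.mem_filter, Finset.mem_filter]
      have := Finset.mem_filter.1 hx
      tauto
    have h1 : (Z.card : ℝ) ≤ _ := Nat.cast_le.2
      ((Finset.card_le_card hsplit).trans (Finset.card_union_le _ _))
    push_cast at h1
    linarith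
  refine ⟨pderiv j p, ?_, ?_, cubeProb_le_iff.2 ?_⟩
  · have hdeg : (pderiv j p).totalDegree ≤ 1 := (mem_restrictTotalDegree _ _ _).1 hL.1
    -- A constant ∂ⱼp would be nonzero by the choice of p, hence without zeros, against `hzero`.
    refine le_antisymm hdeg (Nat.one_le_iff_ne_zero.2 fun h0 => ?_)
    rw [totalDegree_eq_zero_iff_eq_C] at h0
    have hne : coeff 0 (pderiv j p) ≠ 0 := fun h => hpR j hj (by rw [h0, h, C_0])
    have hempty : ((boolCube n).filter fun x => eval x (pderiv j p) = 0) = ∅ := by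
      refine Finset.filter_eq_empty_iff.2 fun x _ => ?_
      rw [h0, eval_C]
      exact hne
    rw [hempty, Finset.card_empty, Nat.cast_zero] at hzero
    exact absurd hzero (not_lt.2 (mul_nonneg (half_pos hη).le hM.le))
  · by_contra hsupp
    refine hzero.not_ge (card_zeros_affine_le hη hL (not_le.1 hsupp) (le_trans ?_ (Nat.le_ceil _)))
    exact div_le_div_of_nonneg_left (by norm_num) (by positivity)
      (pow_le_pow_of_le_one hη.le hη1.le (by norm_num))
  · simp only [Set.mem_ofPred_eq]
    refine hsens.trans ?_
    gcongr
    linarith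

end Main
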